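/- Theorem. Let $\Sigma=\{a,b\}$ with $a\prec b$, and let $\preceq$ be the induced lexicographic order on $\Sigma^*$ (a proper prefix of a word is smaller than the word). A word of length $1$ is a \emph{Nyldon word}, and recursively a word $w$ of length greater than $1$ is a Nyldon word if and only if there is no factorization $w=\gamma_1\cdots\gamma_m$ with $m\ge 2$, each $\gamma_i$ a (nonempty) Nyldon word shorter than $w$, and $\gamma_i\preceq\gamma_{i+1}$ for $1\le i<m$. For a word $w\in\Sigma^*$ let $\overline{w}$ be the word obtained by exchanging the letters $a$ and $b$, and for nonempty $w$ let $w'$ be $w$ without its last letter. Let $\mathit{TM}_0=a$ and $\mathit{TM}_k=\mathit{TM}_{k-1}\cdot\overline{\mathit{TM}_{k-1}}$ for $k\ge 1$, and let $\mathcal{TM}=\lim_{k\to\infty}\mathit{TM}_k$ be the infinite Thue–Morse word; here finite words $u_k$ converge to an infinite word $x$ if for every position $i$ and all sufficiently large $k$ the word $u_k$ has an $i$-th letter and it equals the $i$-th letter of $x$. Define $w_1=a$, $w_2=b$, $w_3=ba$, $w_4=baabbaa$, and $$w_n=b\cdot \mathit{TM}_{2n-8}\cdot\overline{\mathit{TM}_{2n-6}}\cdot\overline{\mathit{TM}_{2n-6}'}\qquad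 (n\ge 5).$$ Then (1) $\mathcal{TM}=\lim_{n\to\infty}(w_1w_2\cdots w_n)$; (2) $w_n\preceq w_{n+1}$ for every $n\ge 1$; (3) $w_n$ is a Nyldon word for every $n\ge 1$. In particular, there is an infinite sequence of Nyldon words, non-decreasing with respect to $\preceq$, whose infinite product is $\mathcal{TM}$. -/

import Mathlib

open Filter

namespace NyldonTM

/-- Nyldon words over a linearly ordered alphabet, by recursion on the length: every word of
length one is Nyldon, and a word of length greater than one is Nyldon iff it is not the
concatenation of a sequence of at least two shorter Nyldon words that is non-decreasing for the
lexicographic order (the order `≤` of lists). -/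
def IsNyldon {α : Type*} [LinearOrder α] (w : List α) : Prop :=
  w.length = 1 ∨
    (1 < w.length ∧
      ¬ ∃ γ : List (List α),
          2 ≤ γ.length ∧ γ.flatten = w ∧ γ.IsChain (· ≤ ·) ∧
            ∀ u ∈ γ, ∃ _ : u.length < w.length, IsNyldon u)
termination_by w.length

/-- The finite words `u k` converge to the infinite word `x`: each letter of `x` is eventually
the letter of `u k` at the same position (in particular the lengths tend to infinity). -/
def WordLim {α : Type*} (u : ℕ → List α) (x : ℕ → α) : Prop :=
  ∀ i : ℕ, ∀ᶠ k in atTop, (u k)[i]? = some (x i)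

/-- The letter `a` of the binary alphabet `{a ≺ b}`. -/
abbrev a : Bool := false

/-- The letter `b` of the binary alphabet `{a ≺ b}`. -/
abbrev b : Bool := true

/-- The letterwise flip, exchanging `a` and `b`. -/
def flip (w : List Bool) : List Bool := w.map not

/-- The finite Thue-Morse words. -/
def TM : ℕ → List Bool
  | 0 => [a]
  | k + 1 => TM k ++ flip (TM k)

theorem length_TM (k : ℕ) : (TM k).length = 2 ^ k := by
  induction k with
  | zero => rfl
  | succ k ih => simp [TM, flip, ih, pow_succ]; ring

theorem lt_length_TM (i : ℕ) : i < (TM i).length := by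
  rw [length_TM]; exact Nat.lt_two_pow_self

/-- The infinite Thue-Morse word, the limit of the words `TM k` (see `wordLim_TM`). -/
def TMinf (i : ℕ) : Bool := (TM i)[i]'(lt_length_TM i)

theorem wordLim_TM : WordLim TM TMinf := by
  intro i
  filter_upwards [eventually_ge_atTop i] with k hk
  induction k, hk using Nat.le_induction with
  | base => exact List.getElem?_eq_getElem (lt_length_TM i)
  | succ k hk ih =>
    rw [TM, List.getElem?_append_left (lt_of_le_of_lt hk (lt_length_TM k)), ih]

/-- The words `w n`, for `n ≥ 1`; the value at `0` is never used. For a word `u`, `u.dropLast`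
is `u` without its last letter. -/
def w : ℕ → List Bool
  | 0 => []
  | 1 => [a]
  | 2 => [b]
  | 3 => [b, a]
  | 4 => [b, a, a, b, b, a, a]
  | n + 5 =>
      [b] ++ TM (2 * (n + 5) - 8) ++ flip (TM (2 * (n + 5) - 6)) ++
        flip (TM (2 * (n + 5) - 6)).dropLast

/-- The concatenation `v 1 ⋯ v n`. -/
def prefixProd {α : Type*} (v : ℕ → List α) (n : ℕ) : List α :=
  ((List.range' 1 n).map v).flatten

/-- `(v n)` for `n ≥ 1` is a non-decreasing sequence of Nyldon words whose infinite product
is `x`. -/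
def IsNyldonFactorization {α : Type*} [LinearOrder α] (v : ℕ → List α) (x : ℕ → α) : Prop :=
  WordLim (prefixProd v) x ∧ (∀ n ≥ 1, v n ≤ v (n + 1)) ∧ ∀ n ≥ 1, IsNyldon (v n)

end NyldonTM

namespace NyldonTM

/-! ### Nyldon factorizations and Nyldon suffixes. -/

section Nyldon

variable {α : Type*} [LinearOrder α]

/-! The hard part is that `w n` is Nyldon. Proper Nyldon suffixes of a Nyldon word are smaller than
it (`IsNyldonSuffix.lt`), hence the last factor of a non-decreasing Nyldon factorization is the
longest Nyldon suffix. This yields a gluing criterion (`NyldonBounded.append`): if `v < u` and all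
proper Nyldon suffixes of `u` are at most `v`, then `u ++ v` is Nyldon.

Write A for `TM (2 * n + 2)` and Ā for its flip. Moving a `b` from the end to the front of AĀ, AAĀĀ,
AAĀ, AĀĀ gives four words P, R, S, Y. The criterion makes them Nyldon at every level, since the
words of the next level are products of those of the current one (`IsLevel.next`); it also makes PRS
Nyldon, and PRS is `w (n + 5)`.

Monotonicity is a comparison at the first mismatch. Convergence follows from a telescoping formula
for the partial products (`prefixProd_w_add_four`). -/

theorem isNyldon_singleton (x : α) : IsNyldon [x] := by
  rw [IsNyldon]; exact Or.inl rfl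

theorem IsNyldon.ne_nil {u : List α} (h : IsNyldon u) : u ≠ [] := by
  rintro rfl
  rw [IsNyldon] at h
  simp at h

theorem le_append_right (u v : List α) : u ≤ u ++ v :=
  not_lt.1 fun h => List.le_append_left h

/-- A non-decreasing sequence of Nyldon words. -/
def IsNF (γ : List (List α)) : Prop :=
  (∀ u ∈ γ, IsNyldon u) ∧ γ.IsChain (· ≤ ·)

theorem IsNF.append {γ δ : List (List α)} (hγ : IsNF γ) (hδ : IsNF δ)
    (h : ∀ x ∈ γ.getLast?, ∀ y ∈ δ.head?, x ≤ y) : IsNF (γ ++ δ) := by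
  refine ⟨?_, List.isChain_append.2 ⟨hγ.2, hδ.2, h⟩⟩
  intro u hu
  rcases List.mem_append.1 hu with hu | hu
  exacts [hγ.1 u hu, hδ.1 u hu]

theorem IsNF.left {γ δ : List (List α)} (h : IsNF (γ ++ δ)) : IsNF γ :=
  ⟨fun u hu => h.1 u (List.mem_append_left _ hu), (List.isChain_append.1 h.2).1⟩

theorem IsNF.right {γ δ : List (List α)} (h : IsNF (γ ++ δ)) : IsNF δ :=
  ⟨fun u hu => h.1 u (List.mem_append_right _ hu), (List.isChain_append.1 h.2).2.1⟩

theorem IsNyldon.isNF {u : List α} (h : IsNyldon u) : IsNF [u] :=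
  ⟨by simpa using h, List.isChain_singleton _⟩

theorem IsNF.concat {γ : List (List α)} {t v : List α} (h : IsNF (γ ++ [t])) (hv : IsNyldon v)
    (htv : t ≤ v) : IsNF ((γ ++ [t]) ++ [v]) :=
  h.append hv.isNF (by simpa using htv)

theorem exists_isNF (u : List α) : ∃ γ, IsNF γ ∧ γ.flatten = u := by
  by_cases h : IsNyldon u
  · exact ⟨[u], h.isNF, by simp⟩
  · rw [IsNyldon] at h
    push Not at h
    obtain ⟨h1, h2⟩ := h
    rcases Nat.lt_trichotomy u.length 1 with h0 | h0 | h0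
    · exact ⟨[], ⟨by simp, List.isChain_nil⟩, by
        rw [List.length_eq_zero_iff.1 (by omega : u.length = 0)]; rfl⟩
    · exact absurd h0 h1
    · obtain ⟨γ, -, hf, hc, hn⟩ := h2 h0
      exact ⟨γ, ⟨fun v hv => (hn v hv).2, hc⟩, hf⟩

theorem exists_isNF_concat {u : List α} (hu : u ≠ []) :
    ∃ γ g, IsNF (γ ++ [g]) ∧ γ.flatten ++ g = u := by
  obtain ⟨γ, hγ, hf⟩ := exists_isNF u
  rcases List.eq_nil_or_concat' γ with rfl | ⟨δ, g, rfl⟩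
  · exact absurd hf.symm (by simpa using hu)
  · exact ⟨δ, g, hγ, by simpa using hf⟩

/-- Factors are nonempty, so with two or more of them each is automatically shorter than `u`; the
length condition in the definition comes for free. -/
theorem IsNyldon.length_lt_two {u : List α} (hu : IsNyldon u) {γ : List (List α)} (hγ : IsNF γ)
    (hf : γ.flatten = u) : γ.length < 2 := by
  by_contra! hlen
  have hshort : ∀ v ∈ γ, v.length < u.length := by
    intro v hv
    obtain ⟨s, t, rfl⟩ := List.append_of_mem hv
    have hpos : ∀ δ : List (List α), IsNF δ → δ ≠ [] → 0 < δ.flatten.length := by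
      intro δ hδ hne
      obtain ⟨x, δ', rfl⟩ := List.exists_cons_of_ne_nil hne
      have := List.length_pos_iff.2 (hδ.1 x (by simp)).ne_nil
      simp only [List.flatten_cons, List.length_append]; omega
    subst hf
    simp only [List.flatten_append, List.flatten_cons, List.length_append]
    have ht : IsNF t := IsNF.right (γ := s ++ [v]) (by simpa using hγ)
    rcases eq_or_ne s [] with rfl | hs
    · have := hpos t ht (by rintro rfl; simp at hlen)
      omega
    · have := hpos s hγ.left hs
      omega
  rw [IsNyldon] at hu
  rcases hu with h1 | ⟨-, h2⟩
  · obtain ⟨v, γ', rfl⟩ := List.exists_cons_of_ne_nil (l := γ) (by rintro rfl; simp at hlen)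
    have h3 := hshort v (by simp)
    have h4 := List.length_pos_iff.2 (hγ.1 v (by simp)).ne_nil
    omega
  · exact h2 ⟨γ, hlen, hf, hγ.2, fun v hv => ⟨hshort v hv, hγ.1 v hv⟩⟩

theorem IsNyldon.eq_singleton {u : List α} (hu : IsNyldon u) {γ : List (List α)} (hγ : IsNF γ)
    (hf : γ.flatten = u) : γ = [u] := by
  have h := hu.length_lt_two hγ hf
  match γ, h with
  | [], _ => exact absurd hf.symm (by simpa using hu.ne_nil)
  | [v], _ => simpa using hf

/-- `s` is a proper suffix of `u` that is a Nyldon word. -/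
def IsNyldonSuffix (s u : List α) : Prop := IsNyldon s ∧ s <:+ u ∧ s ≠ u

/-- If `δ` began inside an earlier factor `x`, factoring the part of `δ` in `x` would end in some `t
≤ x`; continuing with the later factors would split the Nyldon word `δ`. The hypothesis `H` is kept
explicit because `IsNyldonSuffix.lt` uses this lemma inside its own induction. -/
theorem suffix_last_of_forall_lt {γ : List (List α)} {g δ : List α} (hγ : IsNF (γ ++ [g]))
    (H : ∀ u ∈ γ, ∀ s, IsNyldonSuffix s u → s < u) (hδ : IsNyldon δ)
    (hs : δ <:+ γ.flatten ++ g) : δ <:+ g := by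
  induction γ with
  | nil => simpa using hs
  | cons x γ ih =>
    have hγ' : IsNF (γ ++ [g]) := IsNF.right (γ := [x]) hγ
    refine ih hγ' (fun u hu => H u (List.mem_cons_of_mem _ hu)) ?_
    rw [List.flatten_cons, List.append_assoc] at hs
    obtain ⟨p, hp⟩ := hs
    rcases List.append_eq_append_iff.1 hp with ⟨s, hx, hd⟩ | ⟨q, -, hq⟩
    · rcases eq_or_ne s [] with rfl | hne
      · exact ⟨[], by simpa using hd⟩
      exfalso
      obtain ⟨σ, t, hσ, hf⟩ := exists_isNF_concat hne
      have ht : IsNyldon t := hσ.1 t (by simp)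
      have htx : t ≤ x := by
        by_cases h : t = x
        · exact h.le
        · refine (H x (by simp) t ⟨ht, ?_, h⟩).le
          exact ⟨p ++ σ.flatten, by rw [hx, ← hf, List.append_assoc]⟩
      have hN : IsNF ((σ ++ [t]) ++ (γ ++ [g])) := by
        refine hσ.append hγ' ?_
        have h1 := (List.isChain_cons.1 hγ.2).1
        simp only [List.getLast?_concat, Option.mem_def, Option.some.injEq, forall_eq']
        intro y hy
        exact htx.trans (h1 y hy)
      have := hδ.length_lt_two hN (by simp [hd, ← hf])
      simp at this
      omega
    · exact ⟨q, hq.symm⟩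

theorem IsNyldonSuffix.lt {s u : List α} (hu : IsNyldon u) (h : IsNyldonSuffix s u) : s < u := by
  induction hn : u.length using Nat.strong_induction_on generalizing s u with
  | _ n IH =>
    subst hn
    have IH' : ∀ v, IsNyldon v → v.length < u.length → ∀ s, IsNyldonSuffix s v → s < v :=
      fun v hv hlt s hs => IH v.length hlt hv hs rfl
    obtain ⟨x, u₁, rfl⟩ := List.exists_cons_of_ne_nil hu.ne_nil
    obtain ⟨hs, hsu, hne⟩ := h
    have hsu₁ : s <:+ u₁ := (List.suffix_cons_iff.1 hsu).resolve_left hne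
    have hu₁ : u₁ ≠ [] := by
      rintro rfl
      exact hs.ne_nil (List.suffix_nil.1 hsu₁)
    have key : ∀ {γ : List (List α)} {g δ : List α}, IsNF (γ ++ [g]) → IsNyldon δ →
        (γ.flatten ++ g).length < (x :: u₁).length → δ <:+ γ.flatten ++ g → δ <:+ g := by
      intro γ g δ hγ hδ hlen hsuf
      refine suffix_last_of_forall_lt hγ (fun v hv => IH' v (hγ.1 v (by simp [hv])) ?_) hδ hsuf
      have := (List.sublist_flatten_of_mem hv).length_le
      simp only [List.length_append] at hlen
      omega
    -- By induction `v` is the longest Nyldon suffix of `u₁`, so it suffices to show `v < x :: u₁`.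
    obtain ⟨γ, v, hγ, hf⟩ := exists_isNF_concat hu₁
    have hv : IsNyldon v := hγ.1 v (by simp)
    have hmax : ∀ δ, IsNyldon δ → δ <:+ u₁ → δ <:+ v := fun δ hδ h =>
      key hγ hδ (by rw [hf]; simp) (by rwa [hf])
    have hvu : v < x :: u₁ := by
      obtain ⟨U, r, hU, hUf⟩ := exists_isNF_concat (u := x :: γ.flatten) (by simp)
      have hr : IsNyldon r := hU.1 r (by simp)
      have huv : U.flatten ++ (r ++ v) = x :: u₁ := by
        rw [← hf, ← List.append_assoc, hUf]; rfl
      have hrv : v < r := by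
        by_contra! hle
        have := hu.length_lt_two (hU.concat hv hle) (by simp [huv])
        simp at this
      rcases eq_or_ne U [] with rfl | hU0
      · simp only [List.flatten_nil, List.nil_append] at huv
        rw [← huv]
        exact hrv.trans_le (le_append_right r v)
      -- Now `r ++ v` is shorter than the whole word, so its last factor is again `v`; what precedes
      -- factors `r`, hence is `r` itself, forcing `r ≤ v`.
      · exfalso
        obtain ⟨y, U', rfl⟩ := List.exists_cons_of_ne_nil hU0
        obtain ⟨y₀, y', rfl⟩ := List.exists_cons_of_ne_nil (hU.1 y (by simp)).ne_nil
        have hsuf : r ++ v <:+ u₁ := by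
          simp only [List.flatten_cons, List.cons_append, List.cons.injEq] at huv
          exact ⟨y' ++ U'.flatten, huv.2⟩
        obtain ⟨Z, z, hZ, hZf⟩ := exists_isNF_concat (u := r ++ v) (by simp [hr.ne_nil])
        have hzv : z <:+ v := hmax z (hZ.1 z (by simp))
          ((List.suffix_append _ _).trans (by rwa [hZf]))
        have hvz : v <:+ z := key hZ hv
          (by rw [hZf, List.length_cons]; exact Nat.lt_succ_of_le hsuf.length_le)
          (by rw [hZf]; exact List.suffix_append _ _)
        obtain rfl : z = v := hzv.eq_of_length_le hvz.length_le
        obtain rfl := hr.eq_singleton hZ.left (List.append_cancel_right hZf)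
        exact absurd hrv (not_lt.2 (by simpa [IsNF] using hZ.2))
    rcases eq_or_ne s v with rfl | hsv
    · exact hvu
    · refine (IH' v hv ?_ s ⟨hs, hmax s hs hsu₁, hsv⟩).trans hvu
      rw [← hf]; simp

theorem IsNF.suffix_last {γ : List (List α)} {g δ : List α} (hγ : IsNF (γ ++ [g]))
    (hδ : IsNyldon δ) (hs : δ <:+ γ.flatten ++ g) : δ <:+ g :=
  suffix_last_of_forall_lt hγ (fun u hu _ h => h.lt (hγ.1 u (by simp [hu]))) hδ hs

/-- `u` is a Nyldon word all of whose proper Nyldon suffixes are at most `z`. -/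
def NyldonBounded (u z : List α) : Prop :=
  IsNyldon u ∧ ∀ s, IsNyldonSuffix s u → s ≤ z

theorem NyldonBounded.mono {u z z' : List α} (h : NyldonBounded u z) (hz : z ≤ z') :
    NyldonBounded u z' :=
  ⟨h.1, fun s hs => (h.2 s hs).trans hz⟩

theorem nyldonBounded_singleton (x : α) (z : List α) : NyldonBounded [x] z := by
  refine ⟨isNyldon_singleton x, fun s ⟨hs, hsx, hne⟩ => ?_⟩
  rcases List.suffix_cons_iff.1 hsx with h | h
  · exact absurd h hne
  · exact absurd (List.suffix_nil.1 h) hs.ne_nil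

/-- A Nyldon suffix cannot start strictly inside `u`: the factorization of its part in `u` would end
in a word at most `z ≤ v`, and `v` could be added as a further factor. So the last factor of `u ++
v` is `v` or everything, and `v < u` excludes the former. -/
theorem NyldonBounded.append {u v z : List α} (hu : NyldonBounded u z) (hv : IsNyldon v)
    (hzv : z ≤ v) (hvu : v < u) : NyldonBounded (u ++ v) v := by
  have hext : ∀ s, s <:+ u → s ≠ u → s ≠ [] → ¬ IsNyldon (s ++ v) := by
    intro s hs hsu hs0 hN
    obtain ⟨σ, t, hσ, rfl⟩ := exists_isNF_concat hs0
    have ht : t ≤ v := by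
      refine (hu.2 t ⟨hσ.1 t (by simp), (List.suffix_append _ _).trans hs, ?_⟩).trans hzv
      rintro rfl
      exact hsu (hs.eq_of_length_le (by simp))
    have := hN.length_lt_two (hσ.concat hv ht) (by simp)
    simp at this
  have hsplit : ∀ z', IsNyldon z' → z' <:+ u ++ v → z' <:+ v ∨ z' = u ++ v := by
    intro z' hz' hsuf
    obtain ⟨p, hp⟩ := hsuf
    rcases List.append_eq_append_iff.1 hp with ⟨s, hx, rfl⟩ | ⟨q, -, hq⟩
    · rcases eq_or_ne s [] with rfl | hs0
      · exact Or.inl List.suffix_rfl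
      · rcases eq_or_ne s u with rfl | hsu
        · exact Or.inr rfl
        · exact absurd hz' (hext s ⟨p, hx.symm⟩ hsu hs0)
    · exact Or.inl ⟨q, hq.symm⟩
  constructor
  · obtain ⟨Z, y, hZ, hZf⟩ := exists_isNF_concat (u := u ++ v) (by simp [hv.ne_nil])
    have hy : IsNyldon y := hZ.1 y (by simp)
    have hvy : v <:+ y := hZ.suffix_last hv (by rw [hZf]; exact List.suffix_append _ _)
    rcases hsplit y hy (by rw [← hZf]; exact List.suffix_append _ _) with h | h
    · obtain rfl : y = v := h.eq_of_length_le hvy.length_le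
      obtain rfl := hu.1.eq_singleton hZ.left (List.append_cancel_right hZf)
      exact absurd hvu (not_lt.2 (by simpa using hZ.2))
    · rwa [← h]
  · rintro s ⟨hs, hsuf, hne⟩
    have hsv := (hsplit s hs hsuf).resolve_right hne
    rcases eq_or_ne s v with rfl | h
    · exact le_rfl
    · exact (IsNyldonSuffix.lt hv ⟨hs, hsv, h⟩).le

end Nyldon

/-! ### Comparison at a mismatch, and the four-word induction. -/

/-- `u` is smaller than `v` because of the first position where they differ. -/
def StrongLT (u v : List Bool) : Prop :=
  ∃ p x y, u = p ++ a :: x ∧ v = p ++ b :: y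

namespace StrongLT

variable {u v : List Bool}

theorem append_left (h : StrongLT u v) (p : List Bool) : StrongLT (p ++ u) (p ++ v) := by
  obtain ⟨q, x, y, rfl, rfl⟩ := h
  exact ⟨p ++ q, x, y, by simp, by simp⟩

theorem append (h : StrongLT u v) (x y : List Bool) : StrongLT (u ++ x) (v ++ y) := by
  obtain ⟨q, x', y', rfl, rfl⟩ := h
  exact ⟨q, x' ++ x, y' ++ y, by simp, by simp⟩

/-- Unlike `<`, which may hold because of a proper prefix, a mismatch survives any extension to the
right. -/
theorem of_prefix (h : StrongLT u v) {u' v' : List Bool} (hu : u <+: u') (hv : v <+: v') :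
    StrongLT u' v' := by
  obtain ⟨x, rfl⟩ := hu
  obtain ⟨y, rfl⟩ := hv
  exact h.append x y

theorem lt (h : StrongLT u v) : u < v := by
  obtain ⟨p, x, y, rfl, rfl⟩ := h
  exact List.append_left_lt (List.Lex.rel (by decide))

end StrongLT

/-- Four Nyldon words of one level of the construction, with a common prefix `c`, satisfying the
order relations that make the next level possible. -/
structure IsLevel (c P R S Y : List Bool) : Prop where
  prefix_P : c <+: P
  prefix_R : c <+: R
  prefix_S : c <+: S
  prefix_Y : c <+: Y
  S_prefix_R : S <+: R
  P_prefix_Y : P <+: Y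
  S_lt_P : StrongLT S P
  Sc_lt_R : StrongLT (S ++ c) R
  Pc_lt_Y : StrongLT (P ++ c) Y
  bounded_P : NyldonBounded P S
  bounded_R : NyldonBounded R S
  bounded_Y : NyldonBounded Y R
  nyldon_S : IsNyldon S

namespace IsLevel

variable {c P R S Y : List Bool}

theorem bounded_PS (h : IsLevel c P R S Y) : NyldonBounded (P ++ S) S :=
  h.bounded_P.append h.nyldon_S le_rfl h.S_lt_P.lt

theorem bounded_RS (h : IsLevel c P R S Y) : NyldonBounded (R ++ S) S :=
  h.bounded_R.append h.nyldon_S le_rfl ((le_append_right S c).trans_lt h.Sc_lt_R.lt)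

theorem R_lt_P (h : IsLevel c P R S Y) : StrongLT R P :=
  h.S_lt_P.of_prefix h.S_prefix_R List.prefix_rfl

theorem bounded_PRS (h : IsLevel c P R S Y) : NyldonBounded (P ++ (R ++ S)) (R ++ S) := by
  refine h.bounded_P.append h.bounded_RS.1 ?_ ?_
  · obtain ⟨t, rfl⟩ := h.S_prefix_R
    rw [List.append_assoc]
    exact le_append_right _ _
  · exact (h.R_lt_P.of_prefix (List.prefix_append _ _) List.prefix_rfl).lt

/-- Since `S` is a prefix of `R` and `P` of `Y`, a mismatch appears only after appending the common
prefix `c`. With `Y` as the new common prefix, both such comparisons reduce to `S ++ Y` against `R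
++ S`, which the old `Sc_lt_R` decides. -/
theorem next (h : IsLevel c P R S Y) :
    IsLevel Y (Y ++ (P ++ S)) ((Y ++ R) ++ (P ++ (R ++ S))) ((Y ++ R) ++ (P ++ S))
      (Y ++ (P ++ (R ++ S))) := by
  have hSR : P ++ S <+: P ++ (R ++ S) :=
    List.prefix_append_right_inj _ |>.2 (h.S_prefix_R.trans (List.prefix_append _ _))
  have hTY : StrongLT (P ++ S) Y :=
    h.Pc_lt_Y.of_prefix (List.prefix_append_right_inj _ |>.2 h.prefix_S) List.prefix_rfl
  have hWY : StrongLT (P ++ (R ++ S)) Y := hTY.of_prefix hSR List.prefix_rfl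
  have hRT : R ≤ P ++ S := (h.R_lt_P.of_prefix List.prefix_rfl (List.prefix_append _ _)).lt.le
  have hRW : R ≤ P ++ (R ++ S) :=
    (h.R_lt_P.of_prefix List.prefix_rfl (List.prefix_append _ _)).lt.le
  have hRY : R < Y := (h.R_lt_P.of_prefix List.prefix_rfl h.P_prefix_Y).lt
  have hX : NyldonBounded (Y ++ R) R := h.bounded_Y.append h.bounded_R.1 le_rfl hRY
  have hSY : StrongLT (S ++ Y) (R ++ S) :=
    h.Sc_lt_R.of_prefix (List.prefix_append_right_inj _ |>.2 h.prefix_Y) (List.prefix_append _ _)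
  have hYX : ∀ t, Y <+: (Y ++ R) ++ t := fun t =>
    (List.prefix_append Y R).trans (List.prefix_append _ t)
  exact
  { prefix_P := List.prefix_append _ _
    prefix_R := hYX _
    prefix_S := hYX _
    prefix_Y := List.prefix_append _ _
    S_prefix_R := List.prefix_append_right_inj _ |>.2 hSR
    P_prefix_Y := List.prefix_append_right_inj _ |>.2 hSR
    S_lt_P := by
      rw [List.append_assoc]
      exact (h.R_lt_P.append _ _).append_left Y
    Sc_lt_R := by simpa using hSY.append_left ((Y ++ R) ++ P)
    Pc_lt_Y := by simpa using hSY.append_left (Y ++ P)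
    bounded_P := (h.bounded_Y.append h.bounded_PS.1 hRT hTY.lt).mono
      (hTY.of_prefix List.prefix_rfl (hYX _)).lt.le
    bounded_R := (hX.append h.bounded_PRS.1 hRW
      (hWY.of_prefix List.prefix_rfl (List.prefix_append _ _)).lt).mono
      (hWY.of_prefix List.prefix_rfl (hYX _)).lt.le
    bounded_Y := (h.bounded_Y.append h.bounded_PRS.1 hRW hWY.lt).mono
      (hWY.of_prefix List.prefix_rfl (hYX _)).lt.le
    nyldon_S := (hX.append h.bounded_PS.1 hRT
      (hTY.of_prefix List.prefix_rfl (List.prefix_append _ _)).lt).1 }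

end IsLevel

theorem level_zero : IsLevel [b,a,b,b] [b,a,b,b,a,b,a,a]
    [b,a,b,b,a,a,b,b,a,b,a,a,b,b,a,a] [b,a,b,b,a,a,b,b,a,b,a,a]
    [b,a,b,b,a,b,a,a,b,b,a,a] := by
  have ha : ∀ z, NyldonBounded [a] z := nyldonBounded_singleton a
  have hb : ∀ z, NyldonBounded [b] z := nyldonBounded_singleton b
  -- Lower-case names spell the words. Each appended word becomes the new bound, so the next one
  -- appended must be at least as large.
  have ba := (hb [a]).append (ha []).1 (by decide) (by decide)
  have baa := ba.append (ha []).1 (by decide) (by decide)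
  have bab := ba.append (hb []).1 (by decide) (by decide)
  have baab := baa.append (hb []).1 (by decide) (by decide)
  have babba := bab.append ba.1 (by decide) (by decide)
  have baabba := baab.append ba.1 (by decide) (by decide)
  have baabbaa := baab.append baa.1 (by decide) (by decide)
  have baabbabaa := baabba.append baa.1 (by decide) (by decide)
  have babbaabba := bab.append baabba.1 (by decide) (by decide)
  have P := babba.append baa.1 (by decide) (by decide)
  have Y := babba.append baabbaa.1 (by decide) (by decide)
  have R := babbaabba.append baabbaa.1 (by decide) (by decide)
  have S := bab.append baabbabaa.1 (by decide) (by decide)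
  exact
  { prefix_P := by decide
    prefix_R := by decide
    prefix_S := by decide
    prefix_Y := by decide
    S_prefix_R := by decide
    P_prefix_Y := by decide
    S_lt_P := ⟨[b,a,b,b,a], [b,b,a,b,a,a], [a,a], rfl, rfl⟩
    Sc_lt_R := ⟨[b,a,b,b,a,a,b,b,a,b,a,a,b], [b,b], [a, a], rfl, rfl⟩
    Pc_lt_Y := ⟨[b,a,b,b,a,b,a,a,b], [b,b], [a, a], rfl, rfl⟩
    bounded_P := P.mono (by decide)
    bounded_R := R.mono (by decide)
    bounded_Y := Y.mono (by decide)
    nyldon_S := S.1 }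
-- Thue–Morse blocks and the words `w n`.
theorem flip_append (u v : List Bool) : flip (u ++ v) = flip u ++ flip v :=
  List.map_append

theorem flip_flip (u : List Bool) : flip (flip u) = u := by
  simp [flip, Function.comp_def]

theorem TM_add_two (k : ℕ) : TM (k + 2) = TM k ++ flip (TM k) ++ flip (TM k) ++ TM k := by
  simp [TM, flip_append, flip_flip]

theorem flip_TM_add_two (k : ℕ) :
    flip (TM (k + 2)) = flip (TM k) ++ TM k ++ TM k ++ flip (TM k) := by
  simp [TM_add_two, flip_append, flip_flip]

theorem TM_eq_cons (k : ℕ) : ∃ t, TM k = a :: t := by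
  induction k with
  | zero => exact ⟨[], rfl⟩
  | succ k ih =>
    obtain ⟨t, ht⟩ := ih
    exact ⟨t ++ flip (TM k), by rw [TM]; nth_rw 1 [ht]; rfl⟩

/-- The flip of a Thue-Morse word of even index ends with `b`. -/
theorem flip_TM_dropLast (n : ℕ) : flip (TM (2 * n)).dropLast ++ [b] = flip (TM (2 * n)) := by
  obtain ⟨t, ht⟩ : ∃ t, TM (2 * n) = t ++ [a] := by
    induction n with
    | zero => exact ⟨[], rfl⟩
    | succ n ih =>
      obtain ⟨t, ht⟩ := ih
      refine ⟨TM (2 * n) ++ flip (TM (2 * n)) ++ flip (TM (2 * n)) ++ t, ?_⟩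
      rw [Nat.mul_succ, TM_add_two, List.append_assoc _ t, ← ht]
  rw [ht, List.dropLast_concat, flip_append]
  rfl

theorem w_add_five (n : ℕ) : w (n + 5) = [b] ++ TM (2 * n + 2) ++ flip (TM (2 * n + 4)) ++
    flip (TM (2 * n + 4)).dropLast := by
  rw [w, show 2 * (n + 5) - 8 = 2 * n + 2 by omega, show 2 * (n + 5) - 6 = 2 * n + 4 by omega]

theorem w_add_five_concat (n : ℕ) : w (n + 5) ++ [b] =
    [b] ++ TM (2 * n + 2) ++ flip (TM (2 * n + 4)) ++ flip (TM (2 * n + 4)) := by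
  rw [w_add_five, List.append_assoc, show 2 * n + 4 = 2 * (n + 2) by ring, flip_TM_dropLast]

theorem exists_level (n : ℕ) : ∃ c P R S Y, IsLevel c P R S Y ∧
    (∀ A, A = TM (2 * n + 2) → P ++ [b] = b :: (A ++ flip A) ∧
      R ++ [b] = b :: (A ++ A ++ flip A ++ flip A) ∧
      S ++ [b] = b :: (A ++ A ++ flip A) ∧ Y ++ [b] = b :: (A ++ flip A ++ flip A)) := by
  induction n with
  | zero =>
    refine ⟨_, _, _, _, _, level_zero, ?_⟩
    rintro _ rfl
    decide
  | succ n ih =>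
    obtain ⟨c, P, R, S, Y, h, hb⟩ := ih
    refine ⟨_, _, _, _, _, h.next, ?_⟩
    rintro _ rfl
    obtain ⟨hP, hR, hS, hY⟩ := hb _ rfl
    -- Conjugation by `b` is multiplicative, so only identities between products of blocks A and Ā
    -- remain.
    have key : ∀ {u u' v v' : List Bool}, u ++ [b] = b :: u' → v ++ [b] = b :: v' →
        (u ++ v) ++ [b] = b :: (u' ++ v') := by
      intro u u' v v' hu hv
      rw [List.append_assoc, hv, List.append_cons, hu, List.cons_append]
    have hA := TM_add_two (2 * n + 2)
    have hB := flip_TM_add_two (2 * n + 2)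
    rw [show 2 * (n + 1) + 2 = 2 * n + 2 + 2 by ring, hB, hA]
    refine ⟨(key hY (key hP hS)).trans ?_, (key (key hY hR) (key hP (key hR hS))).trans ?_,
      (key (key hY hR) (key hP hS)).trans ?_, (key hY (key hP (key hR hS))).trans ?_⟩ <;>
    simp only [List.append_assoc]

theorem isNyldon_w_add_five (n : ℕ) : IsNyldon (w (n + 5)) := by
  obtain ⟨c, P, R, S, Y, h, hb⟩ := exists_level n
  obtain ⟨hP, hR, hS, -⟩ := hb _ rfl
  suffices P ++ (R ++ S) = w (n + 5) from this ▸ h.bounded_PRS.1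
  apply List.append_cancel_right (bs := [b])
  rw [w_add_five_concat, show 2 * n + 4 = 2 * n + 2 + 2 by ring, flip_TM_add_two,
    List.append_assoc, List.append_assoc, hS, List.append_cons R, hR, List.cons_append,
    List.append_cons P, hP]
  simp only [List.append_assoc, List.cons_append, List.nil_append]

theorem isNyldon_w (n : ℕ) (hn : 1 ≤ n) : IsNyldon (w n) := by
  match n, hn with
  | 1, _ => exact isNyldon_singleton a
  | 2, _ => exact isNyldon_singleton b
  | 3, _ => exact ((nyldonBounded_singleton b [a]).append (isNyldon_singleton a)
      (by decide) (by decide)).1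
  | 4, _ =>
    have hba := (nyldonBounded_singleton b [a]).append (isNyldon_singleton a)
      (by decide) (by decide)
    have hbaa := hba.append (isNyldon_singleton a) (by decide) (by decide)
    have hbaab := hbaa.append (isNyldon_singleton b) (by decide) (by decide)
    exact (hbaab.append hbaa.1 (by decide) (by decide)).1
  | n + 5, _ => exact isNyldon_w_add_five n

theorem w_le_succ (n : ℕ) (hn : 1 ≤ n) : w n ≤ w (n + 1) := by
  match n, hn with
  | 1, _ => decide
  | 2, _ => decide
  | 3, _ => decide
  | 4, _ => exact StrongLT.lt ⟨[b, a], _, _, rfl, rfl⟩ |>.le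
  | n + 5, _ =>
    obtain ⟨t, ht⟩ := TM_eq_cons (2 * n + 2)
    have h : StrongLT (TM (2 * n + 2)) (flip (TM (2 * n + 2))) :=
      ⟨[], t, flip t, by simpa using ht, by rw [ht]; rfl⟩
    have e : w (n + 5 + 1) = [b] ++ TM (2 * n + 4) ++ flip (TM (2 * n + 6)) ++
        flip (TM (2 * n + 6)).dropLast := w_add_five (n + 1)
    rw [e, w_add_five, show 2 * n + 4 = 2 * n + 2 + 2 by ring, flip_TM_add_two (2 * n + 2),
      TM_add_two (2 * n + 2)]
    generalize 2 * n + 6 = m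
    generalize (TM (2 * n + 2) ++ flip (TM (2 * n + 2)) ++ flip (TM (2 * n + 2)) ++
      TM (2 * n + 2)).dropLast = D
    -- After the common prefix bAĀ, the smaller word continues with A and the larger with Ā.
    have h' := ((h.append
      (TM (2 * n + 2) ++ flip (TM (2 * n + 2)) ++ flip D)
      (TM (2 * n + 2) ++ flip (TM m) ++ flip (TM m).dropLast)).append_left
      ([b] ++ TM (2 * n + 2) ++ flip (TM (2 * n + 2))))
    simp only [List.append_assoc] at h' ⊢
    exact h'.lt.le

/-! ### Convergence of the product. -/

theorem prefixProd_succ {α : Type*} (v : ℕ → List α) (n : ℕ) :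
    prefixProd v (n + 1) = prefixProd v n ++ v (n + 1) := by
  simp [prefixProd, List.range'_concat, Nat.add_comm]

/-- The leading `b` of `w (n + 5)` supplies the letter missing from the previous product: AĀĀ
followed by A is the next block. -/
theorem prefixProd_w_add_four (n : ℕ) : prefixProd w (n + 4) ++ [b] =
    TM (2 * n + 2) ++ flip (TM (2 * n + 2)) ++ flip (TM (2 * n + 2)) := by
  induction n with
  | zero => decide
  | succ n ih =>
    have e : prefixProd w (n + 1 + 4) = prefixProd w (n + 4) ++ w (n + 5) :=
      prefixProd_succ w (n + 4)
    rw [e, List.append_assoc, w_add_five_concat, List.append_assoc, List.append_assoc,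
      ← List.append_assoc, ih, show 2 * (n + 1) + 2 = 2 * n + 2 + 2 by ring,
      show 2 * n + 4 = 2 * n + 2 + 2 by ring, TM_add_two (2 * n + 2)]
    simp only [List.append_assoc]

theorem wordLim_w : WordLim (prefixProd w) TMinf := by
  intro i
  obtain ⟨N, hN⟩ := eventually_atTop.1 (wordLim_TM i)
  filter_upwards [eventually_ge_atTop (N + i + 4)] with k hk
  obtain ⟨n, rfl⟩ := Nat.exists_eq_add_of_le' (by omega : 4 ≤ k)
  have hlen := congrArg List.length (prefixProd_w_add_four n)
  have hi : 2 * n + 2 < 2 ^ (2 * n + 2) := Nat.lt_two_pow_self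
  simp only [List.length_append, length_TM, flip, List.length_map, List.length_singleton] at hlen
  rw [← List.getElem?_append_left (l₂ := [b]) (by omega), prefixProd_w_add_four,
    List.append_assoc, List.getElem?_append_left (by rw [length_TM]; omega)]
  exact hN _ (by omega)

end NyldonTM

theorem mainTheorem3 :
    (NyldonTM.WordLim (NyldonTM.prefixProd NyldonTM.w) NyldonTM.TMinf ∧
      (∀ n : ℕ, 1 ≤ n → NyldonTM.w n ≤ NyldonTM.w (n + 1)) ∧
      (∀ n : ℕ, 1 ≤ n → NyldonTM.IsNyldon (NyldonTM.w n))) ∧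
    (∃ v : ℕ → List Bool, NyldonTM.IsNyldonFactorization v NyldonTM.TMinf) :=
  ⟨⟨NyldonTM.wordLim_w, NyldonTM.w_le_succ, NyldonTM.isNyldon_w⟩,
    NyldonTM.w, NyldonTM.wordLim_w, NyldonTM.w_le_succ, NyldonTM.isNyldon_w⟩
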